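/- Let $G$ be a non-compact, locally compact, second countable (Hausdorff) group with the Haagerup property. Let $S$ be a compact metric space on which $G$ acts continuously, with Borel $\sigma$-algebra $\mathcal B_S$, and let $\nu$ be a $G$-invariant Borel probability measure with support $S$ such that (a) the action is strongly mixing: $\lim_{g\to\infty}\nu(gA\cap B)=\nu(A)\nu(B)$ for all $A,B\in\mathcal B_S$; (b) $(A_n)_{n\ge1}\subset\mathcal B_S$ is a sequence with $\nu(A_n)=\frac12$ for all $n$ and $\lim_{n\to\infty}\sup_{g\in K}\nu(gA_n\bigtriangleup A_n)=0$ for every compact $K\subset G$. Let $X=\prod_{n\ge1}S$ with the diagonal action of $G$. Let $\mathcal F_0$ be the family of sets $\prod_n B_n$, $B_n\in\mathcal B_S$, such that the partial products $\prod_{n\le N}2\nu(B_n)$ converge as $N\to\infty$ to a limit in $[0,\infty)$, which is denoted by $\prod_n2\nu(B_n)$. Put $\mathcal F_{n}=\{B\setminus A: A,B\in\mathcal F_{n-1}\}$ for $n\geq 1$ and $\mathcal F=\bigcup_{n\ge0}\mathcal F_n$. For $A\in\mathcal F$ choose $B=\prod_nB_n\in\mathcal F_0$ with $A\subset B$ and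 put $\mu(A)=\mathbb P_B(A)\prod_n2\nu(B_n)$ if $\nu(B_n)>0$ for all $n$, where $\mathbb P_B=\bigotimes_n\nu(\,\cdot\,|B_n)$, and $\mu(A)=0$ otherwise; this does not depend on $B$. Let $\mu$ also denote the Carathéodory extension to $\sigma(\mathcal F)$, so that $\mu(E)$ is the infimum of $\sum_m\mu(E_m)$ over all countable covers of $E$ by sets $E_m\in\mathcal F$ (and $\infty$ if there are none). Then: 1. $\mu(\prod_nB_n)=\prod_n2\nu(B_n)$ for every $\prod_nB_n\in\mathcal F_0$. 2. $(X,\sigma(\mathcal F),\mu,G)$ is a $C_0$-dynamical system: every $g\in G$ acts as a $\mu$-preserving automorphism of $(X,\sigma(\mathcal F))$, and $\lim_{g\to\infty}\mu(gA\cap B)=0$ for all $A,B\in\sigma(\mathcal F)$ with $\mu(A),\mu(B)<\infty$. 3. There are indices $n(k,m)$ such that the sets $X_m=\prod_{k\ge1}A_{n(k,m)}$ belong to $\sigma(\mathcal F)$ and the functions $\xi_m=\chi_{X_m}\ge0$ are unit vectors of $L^2(X,\sigma(\mathcal F),\mu)$ such that, for every compact set $K\subset G$, $$\lim_{m\to\infty}\sup_{g\in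 K}\bigl|\langle\pi_X(g)\xi_m|\xi_m\rangle-1\bigr|=0,\qquad\text{where } (\pi_X(g)\xi)(x)=\xi(g^{-1}x).$$ 4. If $G$ is discrete, there is a $G$-invariant set $\Omega\in\sigma(\mathcal F)$ that contains every $X_m$ (so that $L^2(\Omega,\mu)$ contains the sequence $(\xi_m)$) such that the restriction of $\mu$ to $\Omega$ is $\sigma$-finite and $L^2(\Omega,\mu)$ is separable. Moreover, with $\mu$ replaced by its restriction to $\Omega$, the system is again a $C_0$-dynamical system and $(\xi_m)$ is a sequence of non-negative unit vectors of $L^2(\Omega,\mu)$ whose coefficients $\langle\pi_\Omega(g)\xi_m|\xi_m\rangle$ converge to $1$ uniformly on compact sets. -/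

import Mathlib

open MeasureTheory Filter Topology
open scoped ENNReal NNReal Pointwise ZeroAtInfty

namespace HaagerupProduct

section Groups

/-- A complex function on a group is positive definite if all the matrices `φ (gᵢ⁻¹ gⱼ)` are
positive semidefinite. -/
def IsPositiveDefinite {G : Type*} [Group G] (φ : G → ℂ) : Prop :=
  ∀ (m : ℕ) (g : Fin m → G) (c : Fin m → ℂ), ∃ r : ℝ, 0 ≤ r ∧
    ∑ i, ∑ j, (starRingEnd ℂ) (c i) * c j * φ ((g i)⁻¹ * g j) = (r : ℂ)

/-- The Haagerup property: there is a sequence of normalized positive definite functions in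
`C₀(G)` which converges to `1` uniformly on compact sets. -/
def HaagerupProperty (G : Type*) [Group G] [TopologicalSpace G] : Prop :=
  ∃ φ : ℕ → C₀(G, ℂ), (∀ n, φ n 1 = 1 ∧ IsPositiveDefinite (φ n)) ∧
    ∀ K : Set G, IsCompact K →
      TendstoUniformlyOn (fun n g => φ n g) (fun _ => (1 : ℂ)) atTop K

end Groups

section Systems

variable {G Ω : Type*} [Group G] [TopologicalSpace G] [MeasurableSpace Ω] [MulAction G Ω]

/-- A `C₀`-dynamical system: every `g` acts by a measure-preserving map (hence by a
measure-preserving automorphism, as `g⁻¹` does too), and `μ (gA ∩ B) → 0` as `g → ∞`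
for all measurable sets `A`, `B` of finite measure. -/
structure IsC0DynamicalSystem (G : Type*) {Ω : Type*} [Group G] [TopologicalSpace G]
    [MeasurableSpace Ω] [MulAction G Ω] (μ : Measure Ω) : Prop where
  measurePreserving : ∀ g : G, MeasurePreserving (fun x : Ω => g • x) μ μ
  tendsto_zero : ∀ A B : Set Ω, MeasurableSet A → MeasurableSet B → μ A < ∞ → μ B < ∞ →
    Tendsto (fun g : G => μ ((g • A) ∩ B)) (cocompact G) (𝓝 0)

/-- The action is strongly mixing: `ν (gA ∩ B) → ν A * ν B` as `g → ∞`. -/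
def IsStronglyMixing (G : Type*) {Ω : Type*} [Group G] [TopologicalSpace G]
    [MeasurableSpace Ω] [MulAction G Ω] (ν : Measure Ω) : Prop :=
  ∀ A B : Set Ω, MeasurableSet A → MeasurableSet B →
    Tendsto (fun g : G => ν ((g • A) ∩ B)) (cocompact G) (𝓝 (ν A * ν B))

/-- A non-trivial asymptotically invariant sequence: measurable sets of measure `1/2` with
`sup_{g ∈ K} ν (gAₙ ∆ Aₙ) → 0` for every compact `K`. -/
def IsAsymptoticallyInvariant (G : Type*) {Ω : Type*} [Group G] [TopologicalSpace G]
    [MeasurableSpace Ω] [MulAction G Ω] (ν : Measure Ω) (A : ℕ → Set Ω) : Prop :=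
  (∀ n, MeasurableSet (A n) ∧ ν (A n) = 1 / 2) ∧
    ∀ K : Set G, IsCompact K →
      Tendsto (fun n => ⨆ g ∈ K, ν (symmDiff (g • A n) (A n))) atTop (𝓝 0)

/-- The permutation representation on `L²(Ω, μ)`: `(π(g) ξ)(x) = ξ(g⁻¹ x)`. -/
noncomputable def permRep {μ : Measure Ω} (h : IsC0DynamicalSystem G μ) (g : G) :
    Lp ℂ 2 μ →ₗᵢ[ℂ] Lp ℂ 2 μ :=
  Lp.compMeasurePreservingₗᵢ ℂ (fun x : Ω => g⁻¹ • x) (h.measurePreserving g⁻¹)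

/-- `ξ` is a sequence of non-negative unit vectors of `L²(Ω, μ)` whose coefficient functions
`g ↦ ⟨π(g) ξₙ, ξₙ⟩` converge to `1` uniformly on compact sets. -/
def IsAlmostInvariant {μ : Measure Ω} (h : IsC0DynamicalSystem G μ) (ξ : ℕ → Lp ℂ 2 μ) : Prop :=
  (∀ n, ‖ξ n‖ = 1) ∧
  (∀ n, ∀ᵐ x ∂μ, ∃ r : ℝ, 0 ≤ r ∧ ξ n x = (r : ℂ)) ∧
  ∀ K : Set G, IsCompact K →
    TendstoUniformlyOn (fun n g => inner ℂ (permRep h g (ξ n)) (ξ n)) (fun _ => (1 : ℂ)) atTop K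

end Systems

section Families

/-- The box `∏ₙ Aₙ`. -/
def box {S : Type*} (A : ℕ → Set S) : Set (ℕ → S) := {x | ∀ n, x n ∈ A n}

lemma box_eq_pi {S : Type*} (A : ℕ → Set S) : box A = Set.univ.pi A := by
  ext x; simp [box]

lemma box_inter {S : Type*} (A B : ℕ → Set S) :
    box A ∩ box B = box (fun n => A n ∩ B n) := by
  ext x; simp [box, forall_and]

variable {S : Type*} [MeasurableSpace S]

/-- The partial products `∏_{n < N} 2 ν(Aₙ)`. -/
noncomputable def partialProd (ν : Measure S) (A : ℕ → Set S) (N : ℕ) : ℝ≥0∞ :=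
  ∏ n ∈ Finset.range N, 2 * ν (A n)

/-- The sets `Aₙ` are measurable and the partial products of `∏ₙ 2 ν(Aₙ)` converge to some
limit in `[0, ∞)`. -/
def IsAdmissible (ν : Measure S) (A : ℕ → Set S) : Prop :=
  (∀ n, MeasurableSet (A n)) ∧ ∃ c : ℝ≥0, Tendsto (partialProd ν A) atTop (𝓝 (c : ℝ≥0∞))

/-- The infinite product `∏ₙ 2 ν(Aₙ)`, as the limit of the partial products. -/
noncomputable def boxValue (ν : Measure S) (A : ℕ → Set S) : ℝ≥0∞ :=
  limUnder atTop (partialProd ν A)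

/-- The families `𝓕ₙ`: `𝓕₀` consists of the boxes `∏ₙ Aₙ` for which the infinite product
exists, and `𝓕ₙ₊₁` of the differences of two members of `𝓕ₙ`. -/
def familyStep (ν : Measure S) : ℕ → Set (Set (ℕ → S))
  | 0 => {E | ∃ A : ℕ → Set S, IsAdmissible ν A ∧ E = box A}
  | n + 1 => {E | ∃ A ∈ familyStep ν n, ∃ B ∈ familyStep ν n, E = B \ A}

/-- The family `𝓕 = ⋃ₙ 𝓕ₙ`. -/
def family (ν : Measure S) : Set (Set (ℕ → S)) := ⋃ n, familyStep ν n

/-- For `B` with `ν(Bₙ) > 0` for all `n`, the finite measure `μ(B) ℙ_B` on the product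
σ-algebra, where `ℙ_B` is the product of the conditional probabilities `ν(· | Bₙ)`;
the zero measure if `ν(Bₙ) = 0` for some `n`. -/
noncomputable def boxMeasure (ν : Measure S) (B : ℕ → Set S) : Measure (ℕ → S) :=
  open scoped Classical in
  if ∀ n, ν (B n) ≠ 0 then
    boxValue ν B • Measure.infinitePi (fun n => ProbabilityTheory.cond ν (B n))
  else 0

/-! ### Facts needed to construct the measure -/

lemma measurableSet_box {A : ℕ → Set S} (hA : ∀ n, MeasurableSet (A n)) :
    MeasurableSet (box A) := by
  rw [box_eq_pi]; exact MeasurableSet.univ_pi hA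

lemma tendsto_boxValue {ν : Measure S} {B : ℕ → Set S} (hB : IsAdmissible ν B) :
    Tendsto (partialProd ν B) atTop (𝓝 (boxValue ν B)) := by
  obtain ⟨c, hc⟩ := hB.2
  exact tendsto_nhds_limUnder ⟨_, hc⟩

lemma boxValue_ne_top {ν : Measure S} {B : ℕ → Set S} (hB : IsAdmissible ν B) :
    boxValue ν B ≠ ∞ := by
  obtain ⟨c, hc⟩ := hB.2
  rw [tendsto_nhds_unique (tendsto_boxValue hB) hc]
  exact ENNReal.coe_ne_top

/-- The value of `boxMeasure` on a box. -/
lemma tendsto_boxMeasure {ν : Measure S} [IsProbabilityMeasure ν] {B E : ℕ → Set S}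
    (hB : IsAdmissible ν B) (hE : ∀ n, MeasurableSet (E n)) :
    Tendsto (partialProd ν (fun n => B n ∩ E n)) atTop (𝓝 (boxMeasure ν B (box E))) := by
  classical
  by_cases h : ∀ n, ν (B n) ≠ 0
  · have : ∀ n, IsProbabilityMeasure (ProbabilityTheory.cond ν (B n)) :=
      fun n => ProbabilityTheory.cond_isProbabilityMeasure (h n)
    have h1 : Tendsto (fun N => ∏ n ∈ Finset.range N, ProbabilityTheory.cond ν (B n) (E n)) atTop
        (𝓝 (Measure.infinitePi (fun n => ProbabilityTheory.cond ν (B n)) (box E))) := by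
      rw [box_eq_pi, Measure.infinitePi_pi_univ _ hE, ENNReal.tprod_eq_iInf_prod (fun _ => prob_le_one)]
      refine (tendsto_atTop_iInf (f := fun s : Finset ℕ =>
        ∏ n ∈ s, ProbabilityTheory.cond ν (B n) (E n)) ?_).comp Filter.tendsto_finset_range
      exact fun s t hst => Finset.prod_le_prod_of_subset_of_le_one' hst
        (fun _ _ _ => prob_le_one)
    have h2 := ENNReal.Tendsto.mul (tendsto_boxValue hB)
      (Or.inr (measure_ne_top (Measure.infinitePi
        (fun n => ProbabilityTheory.cond ν (B n))) (box E))) h1 (Or.inr (boxValue_ne_top hB))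
    have h3 : boxMeasure ν B (box E) = boxValue ν B *
        Measure.infinitePi (fun n => ProbabilityTheory.cond ν (B n)) (box E) := by
      rw [boxMeasure, if_pos h]; rfl
    rw [h3]
    refine h2.congr (fun N => ?_)
    rw [partialProd, partialProd, ← Finset.prod_mul_distrib]
    refine Finset.prod_congr rfl (fun n _ => ?_)
    rw [ProbabilityTheory.cond_apply (hB.1 n), mul_assoc, ← mul_assoc (ν (B n)),
      ENNReal.mul_inv_cancel (h n) (measure_ne_top _ _), one_mul]
  · have h0 : boxMeasure ν B (box E) = 0 := by
      rw [boxMeasure, if_neg h]; rfl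
    rw [h0]
    push Not at h
    obtain ⟨k, hk⟩ := h
    refine tendsto_const_nhds.congr' ?_
    filter_upwards [eventually_gt_atTop k] with N hN
    symm
    refine Finset.prod_eq_zero (Finset.mem_range.2 hN) ?_
    rw [measure_mono_null Set.inter_subset_left hk, mul_zero]

lemma boxMeasure_lt_top {ν : Measure S} [IsProbabilityMeasure ν] {B : ℕ → Set S}
    (hB : IsAdmissible ν B) : IsFiniteMeasure (boxMeasure ν B) := by
  have h1 := tendsto_boxMeasure hB (E := fun _ => Set.univ) (fun _ => MeasurableSet.univ)
  have h2 : box (fun _ : ℕ => (Set.univ : Set S)) = Set.univ := by ext; simp [box]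
  simp only [Set.inter_univ, h2] at h1
  refine ⟨?_⟩
  rw [tendsto_nhds_unique h1 (tendsto_boxValue hB)]
  exact (boxValue_ne_top hB).lt_top

lemma generateFrom_boxes : MeasurableSpace.pi = MeasurableSpace.generateFrom
    (Set.univ.pi '' Set.univ.pi fun _ : ℕ => {s : Set S | MeasurableSet s}) := by
  refine le_antisymm (iSup_le fun i => ?_) (MeasurableSpace.generateFrom_le ?_)
  · rintro _ ⟨s, hs, rfl⟩
    refine MeasurableSpace.measurableSet_generateFrom
      ⟨Function.update (fun _ => Set.univ) i s, fun j _ => ?_, ?_⟩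
    · rcases eq_or_ne j i with rfl | h
      · simpa using hs
      · simp [h]
    · ext x
      simp [Set.mem_pi, Function.update_apply]
  · rintro _ ⟨E, hE, rfl⟩
    exact MeasurableSet.univ_pi fun n => hE n (Set.mem_univ n)

/-- The measures `μ(B) ℙ_B` and `μ(C) ℙ_C` agree on subsets of `B ∩ C`. -/
lemma boxMeasure_congr {ν : Measure S} [IsProbabilityMeasure ν] {B C : ℕ → Set S}
    (hB : IsAdmissible ν B) (hC : IsAdmissible ν C) {A : Set (ℕ → S)} (hA : MeasurableSet A)
    (hAB : A ⊆ box B) (hAC : A ⊆ box C) : boxMeasure ν B A = boxMeasure ν C A := by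
  have := boxMeasure_lt_top hB
  have := boxMeasure_lt_top hC
  have hbox : ∀ E : ℕ → Set S, (∀ n, MeasurableSet (E n)) →
      boxMeasure ν B (box E ∩ (box B ∩ box C)) = boxMeasure ν C (box E ∩ (box B ∩ box C)) := by
    intro E hE
    rw [box_inter, box_inter]
    have hm : ∀ n, MeasurableSet (E n ∩ (B n ∩ C n)) :=
      fun n => (hE n).inter ((hB.1 n).inter (hC.1 n))
    have h1 := tendsto_boxMeasure hB hm
    have h2 := tendsto_boxMeasure hC hm
    have h3 : (fun n => B n ∩ (E n ∩ (B n ∩ C n))) = fun n => C n ∩ (E n ∩ (B n ∩ C n)) := by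
      funext n; ext x; simp only [Set.mem_inter_iff]; tauto
    rw [h3] at h1
    exact tendsto_nhds_unique h1 h2
  have hBC : MeasurableSet (box B ∩ box C) :=
    (measurableSet_box hB.1).inter (measurableSet_box hC.1)
  have key : (boxMeasure ν B).restrict (box B ∩ box C)
      = (boxMeasure ν C).restrict (box B ∩ box C) := by
    refine ext_of_generate_finite _ generateFrom_boxes isPiSystem_pi ?_ ?_
    · rintro _ ⟨E, hE, rfl⟩
      have hE' : ∀ n, MeasurableSet (E n) := fun n => hE n (Set.mem_univ n)
      rw [← box_eq_pi, Measure.restrict_apply (measurableSet_box hE'),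
        Measure.restrict_apply (measurableSet_box hE'), hbox E hE']
    · have := hbox (fun _ => Set.univ) (fun _ => MeasurableSet.univ)
      have h2 : box (fun _ : ℕ => (Set.univ : Set S)) = Set.univ := by ext; simp [box]
      rw [h2] at this
      simpa [Measure.restrict_apply MeasurableSet.univ] using this
  have hsub : A ∩ (box B ∩ box C) = A :=
    Set.inter_eq_left.2 (Set.subset_inter hAB hAC)
  have := congrArg (fun m : Measure (ℕ → S) => m A) key
  simpa only [Measure.restrict_apply hA, hsub] using this

lemma isAdmissible_empty (ν : Measure S) : IsAdmissible ν (fun _ => (∅ : Set S)) := by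
  refine ⟨fun _ => MeasurableSet.empty, 0, ?_⟩
  refine tendsto_const_nhds.congr' ?_
  filter_upwards [eventually_gt_atTop 0] with N hN
  symm
  exact Finset.prod_eq_zero (Finset.mem_range.2 hN) (by simp)

lemma empty_mem_familyStep (ν : Measure S) : ∀ n, (∅ : Set (ℕ → S)) ∈ familyStep ν n
  | 0 => ⟨_, isAdmissible_empty ν, by ext x; simp [box]⟩
  | n + 1 => ⟨∅, empty_mem_familyStep ν n, ∅, empty_mem_familyStep ν n, by simp⟩

lemma familyStep_mono (ν : Measure S) : Monotone (familyStep ν) :=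
  monotone_nat_of_le_succ fun n E hE => ⟨∅, empty_mem_familyStep ν n, E, hE, by simp⟩

lemma empty_mem_family (ν : Measure S) : (∅ : Set (ℕ → S)) ∈ family ν :=
  Set.mem_iUnion.2 ⟨0, empty_mem_familyStep ν 0⟩

lemma diff_mem_family {ν : Measure S} {A B : Set (ℕ → S)} (hA : A ∈ family ν)
    (hB : B ∈ family ν) : B \ A ∈ family ν := by
  obtain ⟨i, hi⟩ := Set.mem_iUnion.1 hA
  obtain ⟨j, hj⟩ := Set.mem_iUnion.1 hB
  exact Set.mem_iUnion.2 ⟨max i j + 1, A, familyStep_mono ν (le_max_left i j) hi, B,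
    familyStep_mono ν (le_max_right i j) hj, rfl⟩

lemma inter_mem_family {ν : Measure S} {A B : Set (ℕ → S)} (hA : A ∈ family ν)
    (hB : B ∈ family ν) : A ∩ B ∈ family ν := by
  rw [← Set.sdiff_sdiff_right_self]
  exact diff_mem_family (diff_mem_family hB hA) hA

lemma exists_box_of_mem_familyStep {ν : Measure S} :
    ∀ (n : ℕ) (A : Set (ℕ → S)), A ∈ familyStep ν n →
      MeasurableSet A ∧ ∃ B, IsAdmissible ν B ∧ A ⊆ box B
  | 0, _, ⟨B, hB, rfl⟩ => ⟨measurableSet_box hB.1, B, hB, subset_rfl⟩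
  | n + 1, _, ⟨A, hA, B, hB, rfl⟩ => by
    obtain ⟨hBm, C, hC, hBC⟩ := exists_box_of_mem_familyStep n B hB
    exact ⟨hBm.diff (exists_box_of_mem_familyStep n A hA).1, C, hC,
      Set.sdiff_subset.trans hBC⟩

lemma measurableSet_of_mem_family {ν : Measure S} {A : Set (ℕ → S)} (hA : A ∈ family ν) :
    MeasurableSet A := by
  obtain ⟨n, hn⟩ := Set.mem_iUnion.1 hA
  exact (exists_box_of_mem_familyStep n A hn).1

lemma exists_box_of_mem_family {ν : Measure S} {A : Set (ℕ → S)} (hA : A ∈ family ν) :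
    ∃ B, IsAdmissible ν B ∧ A ⊆ box B := by
  obtain ⟨n, hn⟩ := Set.mem_iUnion.1 hA
  exact (exists_box_of_mem_familyStep n A hn).2

/-! ### The measure space -/

/-- The premeasure on `𝓕`: `μ(A) = ℙ_B(A) μ(B)`, where `B ∈ 𝓕₀` is any box that contains `A`. -/
noncomputable def premeasure (ν : Measure S) (A : Set (ℕ → S)) (hA : A ∈ family ν) : ℝ≥0∞ :=
  boxMeasure ν (exists_box_of_mem_family hA).choose A

/-- The premeasure does not depend on the choice of the box. -/
lemma premeasure_eq {ν : Measure S} [IsProbabilityMeasure ν] {A : Set (ℕ → S)}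
    (hA : A ∈ family ν) {B : ℕ → Set S} (hB : IsAdmissible ν B) (hAB : A ⊆ box B) :
    premeasure ν A hA = boxMeasure ν B A :=
  boxMeasure_congr (exists_box_of_mem_family hA).choose_spec.1 hB (measurableSet_of_mem_family hA)
    (exists_box_of_mem_family hA).choose_spec.2 hAB

/-- On `𝓕₀` the premeasure is `∏ₙ 2 ν(Bₙ)`. -/
lemma premeasure_box {ν : Measure S} [IsProbabilityMeasure ν] {B : ℕ → Set S}
    (hB : IsAdmissible ν B) (h : box B ∈ family ν) :
    premeasure ν (box B) h = boxValue ν B := by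
  rw [premeasure_eq h hB subset_rfl]
  have h1 := tendsto_boxMeasure hB hB.1
  simp only [Set.inter_self] at h1
  exact tendsto_nhds_unique h1 (tendsto_boxValue hB)

lemma premeasure_empty (ν : Measure S) : premeasure ν ∅ (empty_mem_family ν) = 0 :=
  measure_empty

/-- The product `X = ∏ₙ S`. It is a copy of `ℕ → S`, made to carry the σ-algebra `σ(𝓕)` in place
of the product σ-algebra. -/
def ProductSpace (_ν : Measure S) : Type _ := ℕ → S

instance instMeasurableSpaceProductSpace (ν : Measure S) : MeasurableSpace (ProductSpace ν) :=
  MeasurableSpace.generateFrom (family ν)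

/-- The Carathéodory outer measure: the infimum of `∑ₘ μ(Bₘ)` over all countable covers by
members of `𝓕` (and `∞` if there is no such cover). -/
noncomputable def outer (ν : Measure S) : OuterMeasure (ProductSpace ν) :=
  inducedOuterMeasure (premeasure ν) (empty_mem_family ν) (premeasure_empty ν)

/-- The diagonal action. -/
instance instMulActionProductSpace {G : Type*} [Group G] [MulAction G S] (ν : Measure S) :
    MulAction G (ProductSpace ν) where
  smul g x := fun n => g • x n
  one_smul x := funext fun n => one_smul G (x n)
  mul_smul g h x := funext fun n => mul_smul g h (x n)

/-- The box `∏ₙ Aₙ` as a subset of `X`. -/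
def prodSet (ν : Measure S) (A : ℕ → Set S) : Set (ProductSpace ν) := box A

lemma le_caratheodory (ν : Measure S) [IsProbabilityMeasure ν] :
    instMeasurableSpaceProductSpace ν ≤ (outer ν).caratheodory := by
  refine MeasurableSpace.generateFrom_le fun s hs => ?_
  refine OuterMeasure.ofFunction_caratheodory
    (h₀ := extend_empty (empty_mem_family ν) (premeasure_empty ν)) fun t => ?_
  by_cases ht : t ∈ family ν
  · have h1 := inter_mem_family ht hs
    have h2 := diff_mem_family hs ht
    obtain ⟨B, hB, htB⟩ := exists_box_of_mem_family ht
    rw [extend_eq _ ht, extend_eq _ h1, extend_eq _ h2, premeasure_eq ht hB htB,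
      premeasure_eq h1 hB (Set.inter_subset_left.trans htB),
      premeasure_eq h2 hB (Set.sdiff_subset.trans htB),
      measure_inter_add_sdiff _ (measurableSet_of_mem_family hs)]
  · exact le_iInf fun h => absurd h ht

/-- The measure `μ` on `σ(𝓕)`: the Carathéodory extension of the premeasure. -/
noncomputable def prodMeasure (ν : Measure S) [IsProbabilityMeasure ν] :
    Measure (ProductSpace ν) :=
  (outer ν).toMeasure (le_caratheodory ν)

end Families

end HaagerupProduct

/-!
The premeasure on `𝓕` is, inside a fixed box `B`, the finite measure `μ(B) ℙ_B`; hence it is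
countably subadditive and the Carathéodory extension restricts to it (`outer_of_mem_family`). This
gives the measure of a box. Translation by `g` maps `𝓕` to itself and carries `μ(B) ℙ_B` to
`μ(gB) ℙ_{gB}`, so it preserves the outer measure.

A set of finite measure is covered by countably many boxes, hence, up to small measure, by finitely
many (`exists_tendsto_measure_diff`). So the `C₀` property reduces to two boxes `B` and `C`, where
`μ(gB ∩ C) = μ(C) ∏ₙ ν(gBₙ | Cₙ)` unless some `Cₙ` is null, and then `μ(C) = 0`. By strong
mixing, the product of the first `N` factors tends to `∏_{n < N} ν(Bₙ)` as `g → ∞`. This is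
`2⁻ᴺ ∏_{n < N} 2 ν(Bₙ)`, and it tends to `0` as `N → ∞` because the products `∏_{n < N} 2 ν(Bₙ)`
converge.

If `ν(Bₖ) = 1/2` for all `k`, then the box `B` has measure `1`, and a union bound gives
`1 - μ(gB ∩ B) ≤ ∑ₖ 2 ν(gBₖ ∆ Bₖ)`. From an asymptotically invariant sequence one picks the factors
such that this sum is at most `1 / (m + 1)` on the `m`-th set of a compact exhaustion of `G`; the
coefficient of the indicator function of the box is `μ(gB ∩ B)`.

For discrete, hence countable, `G`, let `Ω` be the union of all translates of these boxes. It is a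
countable union of boxes of finite measure, and on it `σ(𝓕)` is the trace of the product σ-algebra
(`countablyGenerated_iUnion_prodSet`), which is countably generated. So `L²(Ω, μ)` is separable.
-/

namespace HaagerupProduct

/-! ### The product measure and boxes -/

section ProductMeasure

variable {S : Type*} [MeasurableSpace S] {ν : Measure S}

lemma measurableSet_productSpace_of_mem_family {E : Set (ProductSpace ν)} (hE : E ∈ family ν) :
    MeasurableSet E :=
  MeasurableSpace.measurableSet_generateFrom hE

lemma box_mem_family {B : ℕ → Set S} (hB : IsAdmissible ν B) : box B ∈ family ν :=
  Set.mem_iUnion.2 ⟨0, B, hB, rfl⟩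

lemma measurableSet_prodSet {B : ℕ → Set S} (hB : IsAdmissible ν B) :
    MeasurableSet (prodSet ν B) :=
  measurableSet_productSpace_of_mem_family (box_mem_family hB)

lemma outer_apply (E : Set (ProductSpace ν)) :
    outer ν E = ⨅ (t : ℕ → Set (ProductSpace ν)) (_ : E ⊆ ⋃ i, t i),
      ∑' i, extend (premeasure ν) (t i) :=
  rfl

lemma extend_premeasure {E : Set (ProductSpace ν)} (hE : E ∈ family ν) :
    extend (premeasure ν) E = premeasure ν E hE :=
  extend_eq _ hE

lemma mem_family_of_tsum_extend_ne_top {t : ℕ → Set (ProductSpace ν)}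
    (ht : ∑' i, extend (premeasure ν) (t i) ≠ ∞) (i : ℕ) : t i ∈ family ν := by
  by_contra h
  exact ENNReal.ne_top_of_tsum_ne_top ht i (iInf_eq_top.2 fun h' => absurd h' h)

variable [IsProbabilityMeasure ν]

lemma IsAdmissible.inter {B E : ℕ → Set S} (hB : IsAdmissible ν B)
    (hE : ∀ n, MeasurableSet (E n)) : IsAdmissible ν (fun n => B n ∩ E n) := by
  have := boxMeasure_lt_top hB
  refine ⟨fun n => (hB.1 n).inter (hE n), (boxMeasure ν B (box E)).toNNReal, ?_⟩
  rw [ENNReal.coe_toNNReal (measure_ne_top _ _)]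
  exact tendsto_boxMeasure hB hE

lemma boxMeasure_box {B E : ℕ → Set S} (hB : IsAdmissible ν B)
    (hE : ∀ n, MeasurableSet (E n)) :
    boxMeasure ν B (box E) = boxValue ν (fun n => B n ∩ E n) :=
  tendsto_nhds_unique (tendsto_boxMeasure hB hE) (tendsto_boxValue (hB.inter hE))

/-- Countable subadditivity of the premeasure: inside a box that contains `E`, every member of the
cover may be replaced by its trace on `E`, and there the premeasure is a measure. -/
lemma premeasure_le_tsum {E : Set (ProductSpace ν)} (hE : E ∈ family ν)
    {t : ℕ → Set (ProductSpace ν)} (ht : ∀ i, t i ∈ family ν) (hEt : E ⊆ ⋃ i, t i) :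
    premeasure ν E hE ≤ ∑' i, premeasure ν (t i) (ht i) := by
  obtain ⟨B, hB, hEB⟩ := exists_box_of_mem_family hE
  calc premeasure ν E hE = boxMeasure ν B E := premeasure_eq hE hB hEB
    _ ≤ boxMeasure ν B (⋃ i, E ∩ t i) := by
        refine measure_mono fun x hx => ?_
        obtain ⟨i, hi⟩ := Set.mem_iUnion.1 (hEt hx)
        exact Set.mem_iUnion.2 ⟨i, hx, hi⟩
    _ ≤ ∑' i, boxMeasure ν B (E ∩ t i) := measure_iUnion_le _
    _ ≤ ∑' i, premeasure ν (t i) (ht i) := by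
        refine ENNReal.tsum_le_tsum fun i => ?_
        obtain ⟨C, hC, htC⟩ := exists_box_of_mem_family (ht i)
        rw [premeasure_eq (ht i) hC htC, boxMeasure_congr hB hC
          (measurableSet_of_mem_family (inter_mem_family hE (ht i)))
          (Set.inter_subset_left.trans hEB) (Set.inter_subset_right.trans htC)]
        exact measure_mono Set.inter_subset_right

lemma outer_of_mem_family {E : Set (ProductSpace ν)} (hE : E ∈ family ν) :
    outer ν E = premeasure ν E hE := by
  refine le_antisymm ?_ ?_
  · exact (OuterMeasure.ofFunction_le (m_empty := extend_empty (empty_mem_family ν)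
      (premeasure_empty ν)) E).trans_eq (extend_premeasure hE)
  · rw [outer_apply]
    refine le_iInf₂ fun t hEt => ?_
    by_cases ht : ∑' i, extend (premeasure ν) (t i) = ∞
    · rw [ht]; exact le_top
    · have ht' := mem_family_of_tsum_extend_ne_top ht
      refine (premeasure_le_tsum hE ht' hEt).trans_eq (tsum_congr fun i => ?_)
      exact (extend_premeasure (ht' i)).symm

lemma prodMeasure_apply {E : Set (ProductSpace ν)} (hE : MeasurableSet E) :
    prodMeasure ν E = outer ν E :=
  toMeasure_apply _ _ hE

lemma prodMeasure_prodSet {B : ℕ → Set S} (hB : IsAdmissible ν B) :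
    prodMeasure ν (prodSet ν B) = boxValue ν B := by
  have h := box_mem_family hB
  rw [prodMeasure_apply (measurableSet_prodSet hB)]
  exact (outer_of_mem_family h).trans (premeasure_box hB h)

/-- A set of finite measure is covered by countably many boxes of `𝓕₀`. -/
lemma exists_cover_of_prodMeasure_lt_top {E : Set (ProductSpace ν)} (hE : MeasurableSet E)
    (hfin : prodMeasure ν E < ∞) :
    ∃ C : ℕ → ℕ → Set S, (∀ i, IsAdmissible ν (C i)) ∧ E ⊆ ⋃ i, prodSet ν (C i) := by
  rw [prodMeasure_apply hE, outer_apply] at hfin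
  simp only [iInf_lt_iff] at hfin
  obtain ⟨t, hEt, ht⟩ := hfin
  choose C hC htC using fun i =>
    exists_box_of_mem_family (mem_family_of_tsum_extend_ne_top ht.ne i)
  exact ⟨C, hC, hEt.trans (Set.iUnion_mono htC)⟩

/-- A set of finite measure is, up to small measure, contained in finitely many boxes of `𝓕₀`. -/
lemma exists_tendsto_measure_diff {E : Set (ProductSpace ν)} (hE : MeasurableSet E)
    (hfin : prodMeasure ν E < ∞) :
    ∃ C : ℕ → ℕ → Set S, (∀ i, IsAdmissible ν (C i)) ∧
      Tendsto (fun N => prodMeasure ν (E \ ⋃ i ∈ Finset.range N, prodSet ν (C i))) atTop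
        (𝓝 0) := by
  obtain ⟨C, hC, hEC⟩ := exists_cover_of_prodMeasure_lt_top hE hfin
  refine ⟨C, hC, ?_⟩
  have h := tendsto_measure_iInter_atTop (μ := prodMeasure ν)
    (s := fun N => E \ ⋃ i ∈ Finset.range N, prodSet ν (C i))
    (fun N => (hE.diff (Finset.measurableSet_biUnion _
      fun i _ => measurableSet_prodSet (hC i))).nullMeasurableSet)
    (fun M N hMN => Set.sdiff_subset_sdiff_right
      (Set.biUnion_subset_biUnion_left (Finset.range_subset_range.2 hMN)))
    ⟨0, ((measure_mono Set.sdiff_subset).trans_lt hfin).ne⟩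
  have h0 : (⋂ N, E \ ⋃ i ∈ Finset.range N, prodSet ν (C i)) = ∅ := by
    refine Set.eq_empty_of_forall_notMem fun x hx => ?_
    rw [Set.mem_iInter] at hx
    obtain ⟨i, hi⟩ := Set.mem_iUnion.1 (hEC (hx 0).1)
    exact (hx (i + 1)).2 (Set.mem_biUnion (Finset.self_mem_range_succ i) hi)
  rwa [h0, measure_empty] at h

end ProductMeasure

/-! ### The diagonal action and mixing -/

section Action

variable {G : Type*} [Group G] {S : Type*} [MeasurableSpace S] [MulAction G S] {ν : Measure S}

lemma smul_prodSet (g : G) (B : ℕ → Set S) :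
    g • prodSet ν B = prodSet ν (fun n => g • B n) := by
  ext x
  rw [Set.mem_smul_set_iff_inv_smul_mem]
  change (∀ n, g⁻¹ • x n ∈ B n) ↔ ∀ n, x n ∈ g • B n
  simp only [Set.mem_smul_set_iff_inv_smul_mem]

variable [MeasurableConstSMul G S] [SMulInvariantMeasure G S ν]

lemma IsAdmissible.smul {B : ℕ → Set S} (hB : IsAdmissible ν B) (g : G) :
    IsAdmissible ν (fun n => g • B n) := by
  refine ⟨fun n => (hB.1 n).const_smul g, ?_⟩
  have h : partialProd ν (fun n => g • B n) = partialProd ν B := by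
    funext N
    simp only [partialProd, measure_smul]
  rw [h]
  exact hB.2

lemma smul_mem_family (g : G) {E : Set (ProductSpace ν)} (hE : E ∈ family ν) :
    g • E ∈ family ν := by
  obtain ⟨n, hn⟩ := Set.mem_iUnion.1 hE
  refine Set.mem_iUnion.2 ⟨n, ?_⟩
  clear hE
  induction n generalizing E with
  | zero =>
    obtain ⟨B, hB, rfl⟩ := hn
    exact ⟨_, hB.smul g, smul_prodSet g B⟩
  | succ n ih =>
    obtain ⟨A, hA, B, hB, rfl⟩ := hn
    exact ⟨_, ih hA, _, ih hB, Set.smul_set_sdiff⟩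

lemma measurable_smul_productSpace (g : G) : Measurable fun x : ProductSpace ν => g • x := by
  refine measurable_generateFrom fun E hE => ?_
  rw [Set.preimage_smul]
  exact measurableSet_productSpace_of_mem_family (smul_mem_family g⁻¹ hE)

variable [IsProbabilityMeasure ν]

/-- Translation by `g` carries `μ(B) ℙ_B` to `μ(gB) ℙ_{gB}`. -/
lemma map_smul_boxMeasure {B : ℕ → Set S} (hB : IsAdmissible ν B) (g : G) :
    (boxMeasure ν B).map (fun x : ℕ → S => fun n => g • x n)
      = boxMeasure ν (fun n => g • B n) := by
  have := boxMeasure_lt_top hB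
  have hm : Measurable fun x : ℕ → S => fun n => g • x n :=
    measurable_pi_lambda _ fun n => (measurable_pi_apply n).const_smul g
  have hbox : ∀ E : ℕ → Set S, (∀ n, MeasurableSet (E n)) →
      (boxMeasure ν B).map (fun x : ℕ → S => fun n => g • x n) (box E)
        = boxMeasure ν (fun n => g • B n) (box E) := by
    intro E hE
    have hpre : (fun x : ℕ → S => fun n => g • x n) ⁻¹' box E = box (fun n => g⁻¹ • E n) := by
      ext x
      simp [box, Set.mem_smul_set_iff_inv_smul_mem]
    rw [Measure.map_apply hm (measurableSet_box hE), hpre]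
    have h1 := tendsto_boxMeasure hB fun n => (hE n).const_smul g⁻¹
    have h2 := tendsto_boxMeasure (hB.smul g) hE
    refine tendsto_nhds_unique h1 (h2.congr fun N => ?_)
    simp only [partialProd]
    refine Finset.prod_congr rfl fun n _ => ?_
    rw [← measure_inter_inv_smul]
  refine ext_of_generate_finite _ generateFrom_boxes isPiSystem_pi ?_ ?_
  · rintro _ ⟨E, hE, rfl⟩
    rw [← box_eq_pi]
    exact hbox E fun n => hE n (Set.mem_univ n)
  · have h := hbox (fun _ => Set.univ) fun _ => MeasurableSet.univ
    have h2 : box (fun _ : ℕ => (Set.univ : Set S)) = Set.univ := by ext; simp [box]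
    rwa [h2] at h

lemma premeasure_smul (g : G) {E : Set (ProductSpace ν)} (hE : E ∈ family ν) :
    premeasure ν (g • E) (smul_mem_family g hE) = premeasure ν E hE := by
  obtain ⟨B, hB, hEB⟩ := exists_box_of_mem_family hE
  have hm : Measurable fun x : ℕ → S => fun n => g • x n :=
    measurable_pi_lambda _ fun n => (measurable_pi_apply n).const_smul g
  have hsub : g • E ⊆ box fun n => g • B n := by
    have h := Set.smul_set_mono (a := g) hEB
    exact h.trans_eq (smul_prodSet (ν := ν) g B)
  rw [premeasure_eq hE hB hEB, premeasure_eq (smul_mem_family g hE) (hB.smul g) hsub,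
    ← map_smul_boxMeasure hB g,
    Measure.map_apply hm (measurableSet_of_mem_family (smul_mem_family g hE))]
  congr 1
  exact Set.preimage_image_eq (f := fun x : ProductSpace ν => g • x) E (MulAction.injective g)

/-- It is the outer measure that is compared, on all sets: `μ` need not be σ-finite, so equality on
the π-system `𝓕` would not be enough to identify two measures. -/
lemma outer_smul_le (g : G) (E : Set (ProductSpace ν)) : outer ν (g • E) ≤ outer ν E := by
  rw [outer_apply E]
  refine le_iInf₂ fun t hEt => ?_
  by_cases ht : ∑' i, extend (premeasure ν) (t i) = ∞
  · rw [ht]; exact le_top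
  · have ht' := mem_family_of_tsum_extend_ne_top ht
    rw [outer_apply]
    refine (iInf₂_le (fun i => g • t i) ?_).trans_eq (tsum_congr fun i => ?_)
    · rw [← Set.smul_set_iUnion]
      exact Set.smul_set_mono hEt
    · exact (extend_premeasure (smul_mem_family g (ht' i))).trans
        ((premeasure_smul g (ht' i)).trans (extend_premeasure (ht' i)).symm)

lemma outer_smul (g : G) (E : Set (ProductSpace ν)) : outer ν (g • E) = outer ν E := by
  refine le_antisymm (outer_smul_le g E) ?_
  simpa using outer_smul_le g⁻¹ (g • E)

lemma measurePreserving_smul_prodMeasure (g : G) :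
    MeasurePreserving (fun x : ProductSpace ν => g • x) (prodMeasure ν) (prodMeasure ν) := by
  refine ⟨measurable_smul_productSpace g, ?_⟩
  ext E hE
  have hm := measurable_smul_productSpace (ν := ν) g
  rw [Measure.map_apply hm hE, prodMeasure_apply (hm hE), prodMeasure_apply hE, Set.preimage_smul,
    outer_smul]

instance instSMulInvariantMeasureProdMeasure :
    SMulInvariantMeasure G (ProductSpace ν) (prodMeasure ν) :=
  ⟨fun g _ hE => (measurePreserving_smul_prodMeasure g).measure_preimage hE.nullMeasurableSet⟩

instance instMeasurableConstSMulProductSpace : MeasurableConstSMul G (ProductSpace ν) :=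
  ⟨measurable_smul_productSpace⟩

lemma prodMeasure_smul_prodSet_inter {B C : ℕ → Set S} (hB : IsAdmissible ν B)
    (hC : IsAdmissible ν C) (g : G) :
    prodMeasure ν (g • prodSet ν B ∩ prodSet ν C)
      = boxMeasure ν C (box fun n => g • B n) := by
  have h : (g • prodSet ν B ∩ prodSet ν C) = prodSet ν (fun n => C n ∩ g • B n) := by
    rw [smul_prodSet, Set.inter_comm]
    exact box_inter _ _
  rw [h, prodMeasure_prodSet (hC.inter (hB.smul g).1), boxMeasure_box hC (hB.smul g).1]

variable [TopologicalSpace G]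

/-- The mixing property for boxes. By strong mixing of `ν`, the first `N` factors of
`ℙ_C (gB)` tend to `ν (B₀) ⋯ ν (B_{N-1})`, which is `2⁻ᴺ` times a convergent sequence. -/
lemma tendsto_prodMeasure_smul_prodSet_inter (hmix : IsStronglyMixing G ν) {B C : ℕ → Set S}
    (hB : IsAdmissible ν B) (hC : IsAdmissible ν C) :
    Tendsto (fun g : G => prodMeasure ν (g • prodSet ν B ∩ prodSet ν C)) (cocompact G) (𝓝 0) := by
  simp only [prodMeasure_smul_prodSet_inter hB hC]
  -- If some `ν (C n)` vanishes, then `boxMeasure ν C` is the zero measure by definition.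
  by_cases h : ∀ n, ν (C n) ≠ 0
  swap
  · simpa [boxMeasure, h] using tendsto_const_nhds
  have hprob : ∀ n, IsProbabilityMeasure (ProbabilityTheory.cond ν (C n)) :=
    fun n => ProbabilityTheory.cond_isProbabilityMeasure (h n)
  have hle : ∀ (N : ℕ) (g : G), boxMeasure ν C (box fun n => g • B n) ≤
      boxValue ν C * ∏ n ∈ Finset.range N, ProbabilityTheory.cond ν (C n) (g • B n) := by
    intro N g
    rw [boxMeasure, if_pos h, Measure.smul_apply, smul_eq_mul]
    gcongr
    rw [box_eq_pi, Measure.infinitePi_pi_univ _ (hB.smul g).1,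
      ENNReal.tprod_eq_iInf_prod (fun _ => prob_le_one)]
    exact iInf_le _ (Finset.range N)
  have hcond : ∀ n, Tendsto (fun g : G => ProbabilityTheory.cond ν (C n) (g • B n))
      (cocompact G) (𝓝 (ν (B n))) := by
    intro n
    have h1 := ENNReal.Tendsto.const_mul (a := (ν (C n))⁻¹) (hmix (B n) (C n) (hB.1 n) (hC.1 n))
      (Or.inr (ENNReal.inv_ne_top.2 (h n)))
    rw [mul_comm (ν (B n)), ← mul_assoc, ENNReal.inv_mul_cancel (h n) (measure_ne_top _ _),
      one_mul] at h1
    refine h1.congr fun g => ?_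
    rw [ProbabilityTheory.cond_apply (hC.1 n), Set.inter_comm]
  have hlim : ∀ N : ℕ, Tendsto (fun g : G => boxValue ν C *
      ∏ n ∈ Finset.range N, ProbabilityTheory.cond ν (C n) (g • B n)) (cocompact G)
      (𝓝 (boxValue ν C * ∏ n ∈ Finset.range N, ν (B n))) := fun N =>
    ENNReal.Tendsto.const_mul (ENNReal.tendsto_finsetProd_of_ne_top _ (fun n _ => hcond n)
      fun n _ => measure_ne_top _ _) (Or.inr (boxValue_ne_top hC))
  have hzero : Tendsto (fun N => boxValue ν C * ∏ n ∈ Finset.range N, ν (B n)) atTop (𝓝 0) := by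
    have h2 : Tendsto (fun N : ℕ => (2⁻¹ : ℝ≥0∞) ^ N * partialProd ν B N) atTop
        (𝓝 (0 * boxValue ν B)) :=
      ENNReal.Tendsto.mul (ENNReal.tendsto_pow_atTop_nhds_zero_of_lt_one
        (ENNReal.inv_lt_one.2 ENNReal.one_lt_two)) (Or.inr (boxValue_ne_top hB))
        (tendsto_boxValue hB) (Or.inr ENNReal.zero_ne_top)
    have h3 := ENNReal.Tendsto.const_mul (a := boxValue ν C) h2 (Or.inr (boxValue_ne_top hC))
    rw [zero_mul, mul_zero] at h3
    refine h3.congr fun N => ?_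
    rw [partialProd, Finset.prod_mul_distrib, Finset.prod_const, Finset.card_range, 
      ← mul_assoc (2⁻¹ ^ N), ← mul_pow, ENNReal.inv_mul_cancel two_ne_zero ENNReal.ofNat_ne_top,
      one_pow, one_mul]
  rw [ENNReal.tendsto_nhds_zero]
  intro ε hε
  obtain ⟨N, hN⟩ := ((tendsto_order.1 hzero).2 ε hε).exists
  filter_upwards [(tendsto_order.1 (hlim N)).2 ε hN] with g hg
  exact (hle N g).trans hg.le

/-- Strong mixing of `ν` makes the product space a `C₀`-dynamical system. -/
theorem isC0DynamicalSystem_prodMeasure (hmix : IsStronglyMixing G ν) :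
    IsC0DynamicalSystem G (prodMeasure ν) := by
  refine ⟨measurePreserving_smul_prodMeasure, fun A B hA hB hAfin hBfin => ?_⟩
  obtain ⟨C, hC, hAC⟩ := exists_tendsto_measure_diff hA hAfin
  obtain ⟨D, hD, hBD⟩ := exists_tendsto_measure_diff hB hBfin
  rw [ENNReal.tendsto_nhds_zero]
  intro ε hε
  -- Outside of `N` boxes each, `A` and `B` together have measure less than `ε`.
  have hdiff := hAC.add hBD
  rw [add_zero] at hdiff
  obtain ⟨N, hN⟩ := ((tendsto_order.1 hdiff).2 ε hε).exists
  set a := prodMeasure ν (A \ ⋃ i ∈ Finset.range N, prodSet ν (C i)) with ha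
  set b := prodMeasure ν (B \ ⋃ i ∈ Finset.range N, prodSet ν (D i)) with hb
  have hle : ∀ g : G, prodMeasure ν (g • A ∩ B) ≤ (a + b) +
      ∑ i ∈ Finset.range N, ∑ j ∈ Finset.range N,
        prodMeasure ν (g • prodSet ν (C i) ∩ prodSet ν (D j)) := by
    intro g
    have hsub : g • A ∩ B ⊆ (g • (A \ ⋃ i ∈ Finset.range N, prodSet ν (C i)) ∪
        (B \ ⋃ i ∈ Finset.range N, prodSet ν (D i))) ∪
        ⋃ i ∈ Finset.range N, ⋃ j ∈ Finset.range N,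
          (g • prodSet ν (C i) ∩ prodSet ν (D j)) := by
      rintro x ⟨hxA, hxB⟩
      simp only [Set.mem_smul_set_iff_inv_smul_mem, Set.mem_union, Set.mem_sdiff, Set.mem_iUnion,
        Set.mem_inter_iff, exists_prop] at hxA ⊢
      by_cases h1 : ∃ i ∈ Finset.range N, g⁻¹ • x ∈ prodSet ν (C i)
      · by_cases h2 : ∃ j ∈ Finset.range N, x ∈ prodSet ν (D j)
        · obtain ⟨i, hi, hxi⟩ := h1
          obtain ⟨j, hj, hxj⟩ := h2
          exact Or.inr ⟨i, hi, j, hj, hxi, hxj⟩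
        · exact Or.inl (Or.inr ⟨hxB, h2⟩)
      · exact Or.inl (Or.inl ⟨hxA, h1⟩)
    refine (measure_mono hsub).trans ((measure_union_le _ _).trans ?_)
    refine add_le_add ((measure_union_le _ _).trans_eq (by rw [measure_smul])) ?_
    exact (measure_biUnion_finset_le _ _).trans
      (Finset.sum_le_sum fun i _ => measure_biUnion_finset_le _ _)
  have hlim : Tendsto (fun g : G => (a + b) + ∑ i ∈ Finset.range N, ∑ j ∈ Finset.range N,
      prodMeasure ν (g • prodSet ν (C i) ∩ prodSet ν (D j))) (cocompact G) (𝓝 (a + b)) := by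
    have h := tendsto_finsetSum (Finset.range N) fun i _ =>
      tendsto_finsetSum (Finset.range N) fun j _ =>
        tendsto_prodMeasure_smul_prodSet_inter hmix (hC i) (hD j)
    simpa using h.const_add (a + b)
  filter_upwards [(tendsto_order.1 hlim).2 ε hN] with g hg
  exact (hle g).trans hg.le

end Action

/-! ### Coefficients of indicator functions and restriction to invariant sets -/

section Coefficients

variable {G Ω : Type*} [Group G] [TopologicalSpace G] [MeasurableSpace Ω] [MulAction G Ω]
  {μ : Measure Ω}

lemma permRep_indicatorConstLp (h : IsC0DynamicalSystem G μ) (g : G) {X : Set Ω}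
    (hX : MeasurableSet X) (hfin : μ X ≠ ∞) (hgX : MeasurableSet (g • X)) (hgfin : μ (g • X) ≠ ∞) :
    permRep h g (indicatorConstLp 2 hX hfin (1 : ℂ)) = indicatorConstLp 2 hgX hgfin (1 : ℂ) := by
  have h1 : permRep h g (indicatorConstLp 2 hX hfin (1 : ℂ))
      = indicatorConstLp 2 (hX.preimage (h.measurePreserving g⁻¹).measurable)
        (by rwa [(h.measurePreserving g⁻¹).measure_preimage hX.nullMeasurableSet]) (1 : ℂ) := rfl
  rw [h1]
  congr 1
  exact Set.preimage_smul_inv g X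

/-- Let `X m` be sets of measure `1`. As `μ (gX ∩ X) ≤ μ X = 1`, lower bounds for `μ (gX ∩ X)`
control the coefficients of the indicator functions. -/
lemma isAlmostInvariant_of_indicator (h : IsC0DynamicalSystem G μ) {X : ℕ → Set Ω}
    (hX : ∀ m, MeasurableSet (X m)) (hone : ∀ m, μ (X m) = 1) (K : CompactExhaustion G)
    (hK : ∀ m, ∀ g ∈ K m, 1 ≤ μ (g • X m ∩ X m) + ((m : ℝ≥0∞) + 1)⁻¹)
    {ξ : ℕ → Lp ℂ 2 μ} (hξ : ∀ m, ξ m =ᵐ[μ] (X m).indicator fun _ => (1 : ℂ)) :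
    IsAlmostInvariant h ξ := by
  have hfin : ∀ m, μ (X m) ≠ ∞ := fun m => by rw [hone m]; exact ENNReal.one_ne_top
  have hind : ∀ m, ξ m = indicatorConstLp 2 (hX m) (hfin m) (1 : ℂ) := fun m =>
    Lp.ext ((hξ m).trans indicatorConstLp_coeFn.symm)
  have hpre : ∀ (g : G) m, (fun x => g⁻¹ • x) ⁻¹' X m = g • X m :=
    fun g m => Set.preimage_smul_inv g (X m)
  have hgX : ∀ (g : G) m, MeasurableSet (g • X m) := fun g m => by
    rw [← hpre]; exact (hX m).preimage (h.measurePreserving g⁻¹).measurable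
  have hgfin : ∀ (g : G) m, μ (g • X m) ≠ ∞ := fun g m => by
    rw [← hpre, (h.measurePreserving g⁻¹).measure_preimage (hX m).nullMeasurableSet]
    exact hfin m
  have hcoef : ∀ (g : G) m, inner ℂ (permRep h g (ξ m)) (ξ m)
      = ((μ.real (g • X m ∩ X m) : ℝ) : ℂ) := by
    intro g m
    rw [hind m, permRep_indicatorConstLp h g (hX m) (hfin m) (hgX g m) (hgfin g m),
      L2.inner_indicatorConstLp_indicatorConstLp (hgX g m) (hX m) (hgfin g m) (hfin m)]
    simp
  refine ⟨fun m => ?_, fun m => ?_, fun C hC => ?_⟩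
  · rw [hind m, norm_indicatorConstLp two_ne_zero ENNReal.ofNat_ne_top]
    simp [Measure.real, hone m]
  · filter_upwards [hξ m] with x hx
    by_cases hxX : x ∈ X m
    · exact ⟨1, zero_le_one, by simp [hx, hxX]⟩
    · exact ⟨0, le_rfl, by simp [hx, hxX]⟩
  · obtain ⟨M, hM⟩ := K.exists_superset_of_isCompact hC
    rw [Metric.tendstoUniformlyOn_iff]
    intro ε hε
    filter_upwards [eventually_ge_atTop M,
      (tendsto_order.1 tendsto_one_div_add_atTop_nhds_zero_nat).2 ε hε] with m hm hmε g hg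
    have hle : μ (g • X m ∩ X m) ≤ 1 := (measure_mono Set.inter_subset_right).trans_eq (hone m)
    have hlow := hK m g (K.subset hm (hM hg))
    have hinv : ((m : ℝ≥0∞) + 1)⁻¹ ≠ ∞ := by simp
    have hreal : 1 ≤ μ.real (g • X m ∩ X m) + 1 / ((m : ℝ) + 1) := by
      have h1 := ENNReal.toReal_mono (ENNReal.add_ne_top.2
        ⟨(hle.trans_lt ENNReal.one_lt_top).ne, hinv⟩) hlow
      rw [ENNReal.toReal_add (hle.trans_lt ENNReal.one_lt_top).ne hinv, ENNReal.toReal_inv,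
        ENNReal.toReal_add (by simp) (by simp)] at h1
      simpa [Measure.real] using h1
    have hle' : μ.real (g • X m ∩ X m) ≤ 1 := by
      simpa [Measure.real] using ENNReal.toReal_mono ENNReal.one_ne_top hle
    rw [hcoef, dist_eq_norm, ← Complex.ofReal_one, ← Complex.ofReal_sub, Complex.norm_real,
      Real.norm_of_nonneg (by linarith)]
    linarith

/-- A `C₀`-dynamical system may be restricted to an invariant measurable set. -/
lemma IsC0DynamicalSystem.restrict (h : IsC0DynamicalSystem G μ) {Y : Set Ω}
    (hY : MeasurableSet Y) (hinv : ∀ g : G, g • Y = Y) :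
    IsC0DynamicalSystem G (μ.restrict Y) := by
  refine ⟨fun g => ?_, fun A B hA hB hAfin hBfin => ?_⟩
  · have h1 := (h.measurePreserving g).restrict_preimage hY
    rwa [Set.preimage_smul, hinv] at h1
  · rw [Measure.restrict_apply hA] at hAfin
    rw [Measure.restrict_apply hB] at hBfin
    refine (h.tendsto_zero _ _ (hA.inter hY) (hB.inter hY) hAfin hBfin).congr fun g => ?_
    rw [Measure.restrict_apply' hY, Set.smul_set_inter, hinv, ← Set.inter_inter_distrib_right]

end Coefficients

/-! ### Almost invariant boxes -/

section AlmostInvariantBoxes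

variable {S : Type*} [MeasurableSpace S] {ν : Measure S}

lemma partialProd_of_measure_eq_half {B : ℕ → Set S} (hB : ∀ k, ν (B k) = 1 / 2) (N : ℕ) :
    partialProd ν B N = 1 := by
  simp [partialProd, hB, ENNReal.mul_inv_cancel]

lemma isAdmissible_of_measure_eq_half {B : ℕ → Set S}
    (hB : ∀ k, MeasurableSet (B k) ∧ ν (B k) = 1 / 2) : IsAdmissible ν B :=
  ⟨fun k => (hB k).1, 1, by
    simp [funext (partialProd_of_measure_eq_half fun k => (hB k).2)]⟩

lemma boxValue_of_measure_eq_half {B : ℕ → Set S}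
    (hB : ∀ k, MeasurableSet (B k) ∧ ν (B k) = 1 / 2) : boxValue ν B = 1 := by
  refine tendsto_nhds_unique (tendsto_boxValue (isAdmissible_of_measure_eq_half hB)) ?_
  rw [funext (partialProd_of_measure_eq_half fun k => (hB k).2)]
  exact tendsto_const_nhds

variable [IsProbabilityMeasure ν] {G : Type*} [Group G] [MulAction G S] [MeasurableConstSMul G S]
  [SMulInvariantMeasure G S ν]

/-- A union bound: under `ℙ_B`, the `k`-th coordinate lies outside of `gB_k` with probability
`2 ν (B_k \ gB_k)`. -/
lemma one_le_prodMeasure_smul_inter_add {B : ℕ → Set S}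
    (hB : ∀ k, MeasurableSet (B k) ∧ ν (B k) = 1 / 2) (g : G) :
    1 ≤ prodMeasure ν (g • prodSet ν B ∩ prodSet ν B)
      + ∑' k, 2 * ν (symmDiff (g • B k) (B k)) := by
  have hadm := isAdmissible_of_measure_eq_half hB
  have hne : ∀ k, ν (B k) ≠ 0 := fun k => by simp [(hB k).2]
  have hprob : ∀ k, IsProbabilityMeasure (ProbabilityTheory.cond ν (B k)) :=
    fun k => ProbabilityTheory.cond_isProbabilityMeasure (hne k)
  have hgB : ∀ k, MeasurableSet (g • B k) := (hadm.smul g).1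
  rw [prodMeasure_smul_prodSet_inter hadm hadm, boxMeasure, if_pos hne,
    boxValue_of_measure_eq_half hB, one_smul]
  set P := Measure.infinitePi fun k => ProbabilityTheory.cond ν (B k) with hP
  have hcompl : (box fun k => g • B k)ᶜ ⊆ ⋃ k, (fun x : ℕ → S => x k) ⁻¹' (g • B k)ᶜ := by
    intro x hx
    simpa [box] using hx
  rw [← measure_univ (μ := P), ← measure_add_measure_compl (measurableSet_box hgB)]
  gcongr
  refine (measure_mono hcompl).trans ((measure_iUnion_le _).trans
    (ENNReal.tsum_le_tsum fun k => ?_))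
  rw [(measurePreserving_eval_infinitePi
      (fun k => ProbabilityTheory.cond ν (B k)) k).measure_preimage
      (hgB k).compl.nullMeasurableSet,
    ProbabilityTheory.cond_apply (hB k).1, (hB k).2, one_div, inv_inv]
  gcongr
  exact fun x hx => Or.inr ⟨hx.1, hx.2⟩

/-- An asymptotically invariant sequence has terms `A (n k m)` so close to being invariant under
`K m` that, in the union bound for the box `∏ₖ A (n k m)`, the error is at most `1 / (m + 1)`. -/
lemma exists_almost_invariant_boxes [TopologicalSpace G] {A : ℕ → Set S}
    (hA : IsAsymptoticallyInvariant G ν A) (K : CompactExhaustion G) :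
    ∃ n : ℕ → ℕ → ℕ, ∀ m, ∀ g ∈ K m,
      1 ≤ prodMeasure ν (g • prodSet ν (fun k => A (n k m)) ∩ prodSet ν (fun k => A (n k m)))
        + ((m : ℝ≥0∞) + 1)⁻¹ := by
  have hδ : ∀ m : ℕ, ∃ δ : ℕ → ℝ≥0∞, (∀ k, 0 < δ k) ∧ ∑' k, δ k < ((m : ℝ≥0∞) + 1)⁻¹ :=
    fun m => ENNReal.exists_pos_sum_of_countable' (by simp) ℕ
  choose δ hδpos hδsum using hδ
  have hn : ∀ k m, ∃ n, 2 * ⨆ g ∈ K m, ν (symmDiff (g • A n) (A n)) < δ m k := by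
    intro k m
    have h1 := ENNReal.Tendsto.const_mul (a := 2) (hA.2 (K m) (K.isCompact m))
      (Or.inr ENNReal.ofNat_ne_top)
    rw [mul_zero] at h1
    exact ((tendsto_order.1 h1).2 _ (hδpos m k)).exists
  choose n hn using hn
  refine ⟨n, fun m g hg => (one_le_prodMeasure_smul_inter_add (fun k => hA.1 (n k m)) g).trans ?_⟩
  gcongr
  refine (ENNReal.tsum_le_tsum fun k => ?_).trans (hδsum m).le
  refine le_trans ?_ (hn k m).le
  gcongr
  exact le_iSup₂ (f := fun g (_ : g ∈ K m) => ν (symmDiff (g • A (n k m)) (A (n k m)))) g hg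

end AlmostInvariantBoxes

/-! ### Separability on countable unions of boxes -/

section Separability

/-- Only the trace of the σ-algebra on `Y` has to be countably generated: approximations are found
in the subtype `Y` and carried back to `X`. -/
lemma isSeparable_restrict_of_countablyGenerated {X : Type*} [MeasurableSpace X] {μ : Measure X}
    {Y : Set X} (hY : MeasurableSet Y) [MeasurableSpace.CountablyGenerated Y]
    [SigmaFinite (μ.restrict Y)] : IsSeparable (μ.restrict Y) := by
  have hemb := MeasurableEmbedding.subtype_coe hY
  have hsf : SigmaFinite (μ.comap ((↑) : Y → X)) :=
    SigmaFinite.of_map _ measurable_subtype_coe.aemeasurable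
      (by rw [map_comap_subtype_coe hY]; infer_instance)
  obtain ⟨𝒜, h𝒜, hd⟩ := exists_countable_measureDense (μ.comap ((↑) : Y → X))
  refine ⟨(fun t : Set Y => (↑) '' t) '' 𝒜, h𝒜.image _, ?_, fun s hs hfin ε hε => ?_⟩
  · rintro _ ⟨t, ht, rfl⟩
    exact hemb.measurableSet_image.2 (hd.measurable t ht)
  · have key : ∀ s : Set X, μ.restrict Y s = μ.comap ((↑) : Y → X) ((↑) ⁻¹' s) := by
      intro s
      rw [hemb.comap_apply, Subtype.image_preimage_coe, Measure.restrict_apply' hY, Set.inter_comm]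
    rw [key] at hfin
    obtain ⟨t, ht, hst⟩ := hd.approx _ (measurable_subtype_coe hs) hfin ε hε
    refine ⟨_, ⟨t, ht, rfl⟩, ?_⟩
    rwa [key, Set.preimage_symmDiff, Set.preimage_image_eq _ Subtype.val_injective]

variable {S : Type*} [MeasurableSpace S] {ν : Measure S} [IsProbabilityMeasure ν]
  {ι : Type*} [Countable ι] {B : ι → ℕ → Set S}

lemma sigmaFinite_restrict_iUnion_prodSet (hB : ∀ i, IsAdmissible ν (B i)) :
    SigmaFinite ((prodMeasure ν).restrict (⋃ i, prodSet ν (B i))) := by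
  have hY : MeasurableSet (⋃ i, prodSet ν (B i)) :=
    MeasurableSet.iUnion fun i => measurableSet_prodSet (hB i)
  refine Measure.sigmaFinite_of_countable (S := insert (⋃ i, prodSet ν (B i))ᶜ
    (Set.range fun i => prodSet ν (B i))) ((Set.countable_range _).insert _) ?_ ?_
  · rintro _ (rfl | ⟨i, rfl⟩)
    · rw [Measure.restrict_apply hY.compl, Set.compl_inter_self, measure_empty]
      exact ENNReal.zero_lt_top
    · refine (Measure.restrict_apply_le _ _).trans_lt ?_
      rw [prodMeasure_prodSet (hB i)]
      exact (boxValue_ne_top (hB i)).lt_top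
  · rw [Set.sUnion_insert, Set.sUnion_range, Set.compl_union_self]

/-- On a countable union of boxes of `𝓕₀`, the σ-algebra `σ(𝓕)` is the trace of the product
σ-algebra, because cutting down one factor of a box of `𝓕₀` gives a box of `𝓕₀`. -/
lemma countablyGenerated_iUnion_prodSet [MeasurableSpace.CountablyGenerated (ℕ → S)]
    (hB : ∀ i, IsAdmissible ν (B i)) :
    MeasurableSpace.CountablyGenerated (⋃ i, prodSet ν (B i) : Set (ProductSpace ν)) := by
  set Y : Set (ProductSpace ν) := ⋃ i, prodSet ν (B i) with hY
  let f : Y → ℕ → S := fun x => x.1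
  have hle : instMeasurableSpaceProductSpace ν ≤ (MeasurableSpace.pi : MeasurableSpace (ℕ → S)) :=
    MeasurableSpace.generateFrom_le fun E hE => measurableSet_of_mem_family hE
  have hf : Measurable f := by
    refine measurable_pi_lambda _ fun n U hU => ?_
    refine ⟨⋃ i, prodSet ν fun k => B i k ∩ Function.update (fun _ => Set.univ) n U k,
      MeasurableSet.iUnion fun i => measurableSet_prodSet ((hB i).inter fun k => ?_), ?_⟩
    · rcases eq_or_ne k n with rfl | h
      · simpa using hU
      · simp [h]
    · ext x
      have hx : ∃ i, x.1 ∈ prodSet ν (B i) := Set.mem_iUnion.1 x.2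
      have hcut : x.1 ∈ prodSet ν (Function.update (fun _ => Set.univ) n U) ↔ f x n ∈ U := by
        refine ⟨fun h => by simpa using h n, fun h k => ?_⟩
        rcases eq_or_ne k n with rfl | hk
        · simpa using h
        · simp [hk]
      have hsplit : ∀ i, x.1 ∈ prodSet ν (fun k => B i k ∩
          Function.update (fun _ => Set.univ) n U k) ↔ x.1 ∈ prodSet ν (B i) ∧ f x n ∈ U := by
        intro i
        rw [← hcut]
        exact forall_and
      simp only [Set.mem_preimage, Set.mem_iUnion, hsplit]
      exact ⟨fun ⟨_, _, h⟩ => h, fun h => ⟨_, hx.choose_spec, h⟩⟩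
  have heq : (Subtype.instMeasurableSpace : MeasurableSpace Y)
      = MeasurableSpace.comap f MeasurableSpace.pi := by
    refine le_antisymm ?_ hf.comap_le
    rintro _ ⟨E, hE, rfl⟩
    exact ⟨E, hle E hE, rfl⟩
  rw [heq]
  exact MeasurableSpace.CountablyGenerated.comap f

end Separability

end HaagerupProduct

theorem proposition2p8
    {G : Type*} [Group G] [TopologicalSpace G] [IsTopologicalGroup G] [T2Space G]
    [LocallyCompactSpace G] [SecondCountableTopology G] [NoncompactSpace G]
    (_hG : HaagerupProduct.HaagerupProperty G)
    {S : Type*} [MetricSpace S] [CompactSpace S] [MeasurableSpace S] [BorelSpace S]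
    [MulAction G S] [ContinuousSMul G S]
    (ν : Measure S) [IsProbabilityMeasure ν] [SMulInvariantMeasure G S ν]
    (_hsupp : ν.support = Set.univ)
    (hmix : HaagerupProduct.IsStronglyMixing G ν)
    (A : ℕ → Set S) (hA : HaagerupProduct.IsAsymptoticallyInvariant G ν A) :
    -- the measure of a box
    (∀ B : ℕ → Set S, HaagerupProduct.IsAdmissible ν B →
      HaagerupProduct.prodMeasure ν (HaagerupProduct.prodSet ν B)
        = HaagerupProduct.boxValue ν B) ∧
    -- the system is a `C₀`-dynamical system
    ∃ h : HaagerupProduct.IsC0DynamicalSystem G (HaagerupProduct.prodMeasure ν),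
    -- almost invariant vectors, the indicator functions of boxes `X m = ∏ₖ A (n k m)`
    ∃ (n : ℕ → ℕ → ℕ) (X : ℕ → Set (HaagerupProduct.ProductSpace ν))
      (ξ : ℕ → Lp ℂ 2 (HaagerupProduct.prodMeasure ν)),
      (∀ m, X m = HaagerupProduct.prodSet ν (fun k => A (n k m))) ∧
      (∀ m, MeasurableSet (X m)) ∧
      (∀ m, ξ m =ᵐ[HaagerupProduct.prodMeasure ν] (X m).indicator (fun _ => (1 : ℂ))) ∧
      HaagerupProduct.IsAlmostInvariant h ξ ∧
      -- the restriction for discrete `G`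
      (DiscreteTopology G → ∃ Ω : Set (HaagerupProduct.ProductSpace ν),
        MeasurableSet Ω ∧ (∀ g : G, g • Ω = Ω) ∧ (∀ m, X m ⊆ Ω) ∧
        SigmaFinite ((HaagerupProduct.prodMeasure ν).restrict Ω) ∧
        TopologicalSpace.SeparableSpace
          (Lp ℂ 2 ((HaagerupProduct.prodMeasure ν).restrict Ω)) ∧
        ∃ h' : HaagerupProduct.IsC0DynamicalSystem G
            ((HaagerupProduct.prodMeasure ν).restrict Ω),
        ∃ η : ℕ → Lp ℂ 2 ((HaagerupProduct.prodMeasure ν).restrict Ω),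
          (∀ m, η m =ᵐ[(HaagerupProduct.prodMeasure ν).restrict Ω] ξ m) ∧
          HaagerupProduct.IsAlmostInvariant h' η) := by
  open HaagerupProduct in
  have h := isC0DynamicalSystem_prodMeasure hmix
  let K : CompactExhaustion G := default
  obtain ⟨n, hn⟩ := exists_almost_invariant_boxes hA K
  have hhalf : ∀ m k, MeasurableSet (A (n k m)) ∧ ν (A (n k m)) = 1 / 2 := fun m k => hA.1 _
  have hadm : ∀ m, IsAdmissible ν fun k => A (n k m) :=
    fun m => isAdmissible_of_measure_eq_half (hhalf m)
  set X : ℕ → Set (ProductSpace ν) := fun m => prodSet ν fun k => A (n k m) with hXdef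
  have hX : ∀ m, MeasurableSet (X m) := fun m => measurableSet_prodSet (hadm m)
  have hone : ∀ m, prodMeasure ν (X m) = 1 := fun m =>
    (prodMeasure_prodSet (hadm m)).trans (boxValue_of_measure_eq_half (hhalf m))
  have hfin : ∀ m, prodMeasure ν (X m) ≠ ∞ := fun m => by rw [hone m]; exact ENNReal.one_ne_top
  have hξ : ∀ m, indicatorConstLp 2 (hX m) (hfin m) (1 : ℂ) =ᵐ[prodMeasure ν]
      (X m).indicator fun _ => (1 : ℂ) := fun m => indicatorConstLp_coeFn
  refine ⟨fun B hB => prodMeasure_prodSet hB, h, n, X, _, fun m => rfl, hX, hξ,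
    isAlmostInvariant_of_indicator h hX hone K hn hξ, fun hdisc => ?_⟩
  have hcount : Countable G := TopologicalSpace.separableSpace_iff_countable.1 inferInstance
  have hsec : SecondCountableTopology S := UniformSpace.secondCountable_of_separable S
  set Ω : Set (ProductSpace ν) :=
    ⋃ i : G × ℕ, prodSet ν (fun k => i.1 • A (n k i.2)) with hΩdef
  have hadm' : ∀ i : G × ℕ, IsAdmissible ν fun k => i.1 • A (n k i.2) :=
    fun i => (hadm i.2).smul i.1
  have hΩ : MeasurableSet Ω := MeasurableSet.iUnion fun i => measurableSet_prodSet (hadm' i)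
  have hΩX : Ω = ⋃ i : G × ℕ, i.1 • X i.2 := by
    simp only [hΩdef, hXdef, smul_prodSet]
  have hXΩ : ∀ m, X m ⊆ Ω := fun m => by
    rw [hΩX]
    exact (one_smul G (X m)).symm.subset.trans
      (Set.subset_iUnion (fun i : G × ℕ => i.1 • X i.2) (1, m))
  have hinv : ∀ g : G, g • Ω = Ω := fun g => by
    rw [hΩX, Set.smul_set_iUnion]
    refine (Equiv.iSup_congr ((Equiv.mulLeft g).prodCongr (Equiv.refl ℕ)) fun i => ?_)
    exact (smul_smul g i.1 (X i.2)).symm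
  -- `L²` is separable as `σ(𝓕)` is countably generated on `Ω`, although it need not be on `X`.
  have hsf : SigmaFinite ((prodMeasure ν).restrict Ω) := sigmaFinite_restrict_iUnion_prodSet hadm'
  have hcg : MeasurableSpace.CountablyGenerated Ω := countablyGenerated_iUnion_prodSet hadm'
  have hsep : IsSeparable ((prodMeasure ν).restrict Ω) :=
    isSeparable_restrict_of_countablyGenerated hΩ
  have h' := h.restrict hΩ hinv
  have hrestr : ∀ E : Set (ProductSpace ν), ∀ m, (prodMeasure ν).restrict Ω (E ∩ X m)
      = prodMeasure ν (E ∩ X m) := fun E m => by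
    rw [Measure.restrict_apply' hΩ,
      Set.inter_eq_left.2 (Set.inter_subset_right.trans (hXΩ m))]
  have hone' : ∀ m, (prodMeasure ν).restrict Ω (X m) = 1 := fun m => by
    simpa [hone] using hrestr Set.univ m
  have hfin' : ∀ m, (prodMeasure ν).restrict Ω (X m) ≠ ∞ :=
    fun m => by rw [hone' m]; exact ENNReal.one_ne_top
  have hη : ∀ m, indicatorConstLp 2 (hX m) (hfin' m) (1 : ℂ) =ᵐ[(prodMeasure ν).restrict Ω]
      (X m).indicator fun _ => (1 : ℂ) := fun m => indicatorConstLp_coeFn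
  have : Fact ((2 : ℝ≥0∞) ≠ ∞) := ⟨ENNReal.ofNat_ne_top⟩
  have hLp : SecondCountableTopology (Lp ℂ 2 ((prodMeasure ν).restrict Ω)) :=
    Lp.SecondCountableTopology
  refine ⟨Ω, hΩ, hinv, hXΩ, hsf, inferInstance, h', _,
    fun m => (hη m).trans (EventuallyEq.symm (ae_restrict_of_ae (hξ m))),
    isAlmostInvariant_of_indicator h' hX hone' K (fun m g hg => ?_) hη⟩
  rw [hrestr]
  exact hn m g hg
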